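/- Definitions. A \emph{standard solid torus} $T\subset\mathbb R^3$ is the solid of revolution obtained by revolving a disk $D$ of radius $r_T>0$, lying in a plane $\Pi$, about a line $\ell\subset\Pi$ whose distance $R_T$ from the center of $D$ satisfies $R_T>r_T$. The circle traced by the center of $D$ is the \emph{central circle} $C_T$, and the center of $C_T$ is the \emph{center} of $T$. Two disjoint standard solid tori are \emph{linked} if their central circles are linked, i.e. if one of these circles cannot be contracted to a point in the complement of the other. For a set $X$, $\operatorname{aff}X$ is its affine hull. A \emph{simple chain} in a standard solid torus $T$ is a finite family $T_1,\dots,T_k$, $k\ge 3$, of pairwise disjoint standard solid tori such that (i) $T_1\cup\dots\cup T_k\subset T$; (ii) the centers of $T_1,\dots,T_k$ are the subsequent vertices of a regular convex $k$-gon inscribed in $C_T$; (iii) for $i\ne j$, $T_i$ and $T_j$ are linked if and only if $i-j\equiv\pm1\pmod k$. A simple chain $T_1,\dots,T_{2m}$, $m\ge2$, in $T$ is \emph{regular} if (i) all $T_i$ are congruent; (ii) $\operatorname{aff}C_{T_1}=\operatorname{aff}C_{T_3}=\dots=\operatorname{aff}C_{T_{2m-1}}=\operatorname{aff}C_T$;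 (iii) $\operatorname{aff}C_{T_{2i}}\perp\operatorname{aff}C_T$ for $i=1,\dots,m$; (iv) each line $\operatorname{aff}C_{T_{2i}}\cap\operatorname{aff}C_T$, $i=1,\dots,m$, is tangent to the circle $C_T$. Theorem. For a standard solid torus $B\subset\mathbb R^3$ the following are equivalent: (1) $R_B>3r_B$; (2) for each sufficiently large integer $m$ there exist a standard solid torus $T$ and a regular simple chain $T_1,\dots,T_{2m}$ in $T$ such that each $T_i$ ($i=1,\dots,2m$) is congruent to $B$; (3) for each sufficiently large integer $m$ there exist a standard solid torus $\mathbf T$ and a regular simple chain $T_1,\dots,T_{2m}$ in $\mathbf T$ such that each $T_i$ ($i=1,\dots,2m$) is congruent to $B$, and $\mathbf T$ is similar to $B$. -/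

import Mathlib

noncomputable section

/-- Euclidean three-space. -/
abbrev E3 : Type := EuclideanSpace ℝ (Fin 3)

/-- The data of a standard solid torus: its center, a unit vector spanning the direction of the
axis of revolution, the radius `r` of the revolved disk and the distance `R` from the center of
that disk to the axis. (The unit vector and its negative give the same solid torus; all notions
below depend only on the solid torus.) -/
structure StandardSolidTorus where
  center : E3
  axis : E3
  R : ℝ
  r : ℝ
  norm_axis : ‖axis‖ = 1
  r_pos : 0 < r
  r_lt_R : r < R

namespace StandardSolidTorus

/-- The central circle: the circle with the given center and radius `R` in the plane through the
center orthogonal to the axis. -/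
def centralCircle (T : StandardSolidTorus) : Set E3 :=
  {p | inner ℝ T.axis (p - T.center) = 0 ∧ dist p T.center = T.R}

/-- The disk of radius `r` centered at the point `p` of the central circle, in the plane that
contains `p` and the axis of revolution. -/
def meridianDisk (T : StandardSolidTorus) (p : E3) : Set E3 :=
  {x | dist x p ≤ T.r ∧ x ∈ affineSpan ℝ {T.center, T.center + T.axis, p}}

/-- The solid torus as a subset of space: the union of all positions of the revolved disk. -/
def carrier (T : StandardSolidTorus) : Set E3 :=
  ⋃ p ∈ T.centralCircle, T.meridianDisk p

/-- The affine hull of the central circle. -/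
def plane (T : StandardSolidTorus) : AffineSubspace ℝ E3 :=
  affineSpan ℝ T.centralCircle

/-- Two solid tori are congruent: an isometry of space takes one onto the other. -/
def IsCongruent (S T : StandardSolidTorus) : Prop :=
  ∃ f : E3 ≃ᵢ E3, f '' S.carrier = T.carrier

/-- Two solid tori are similar: a similarity of space takes one onto the other. -/
def IsSimilar (S T : StandardSolidTorus) : Prop :=
  ∃ f : E3 ≃ᵈ E3, f '' S.carrier = T.carrier

/-- Two (disjoint) solid tori are linked: their central circles are linked, that is, the central
circle of the first cannot be contracted to a point in the complement of the central circle of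
the second. -/
def IsLinked (S T : StandardSolidTorus) : Prop :=
  ∃ h : S.centralCircle ⊆ T.centralCircleᶜ,
    ¬ (⟨Set.inclusion h, continuous_inclusion h⟩ :
        C(S.centralCircle, (T.centralCircleᶜ : Set E3))).Nullhomotopic

/-- The points `q 0, …, q (k - 1)` are the subsequent vertices of a regular convex `k`-gon
inscribed in the central circle of `T`. -/
def IsInscribedRegularPolygon (T : StandardSolidTorus) {k : ℕ} (q : Fin k → E3) : Prop :=
  ∃ u v : E3, ‖u‖ = 1 ∧ ‖v‖ = 1 ∧ inner ℝ u v = 0 ∧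
    inner ℝ T.axis u = 0 ∧ inner ℝ T.axis v = 0 ∧
    ∀ i : Fin k, q i = T.center +
      T.R • (Real.cos (2 * Real.pi * (i : ℕ) / k) • u + Real.sin (2 * Real.pi * (i : ℕ) / k) • v)

/-- A simple chain `c 0, …, c (k - 1)`, `k ≥ 3`, in the standard solid torus `T`. -/
structure IsSimpleChain (T : StandardSolidTorus) {k : ℕ} (c : Fin k → StandardSolidTorus) :
    Prop where
  three_le : 3 ≤ k
  disjoint : ∀ i j : Fin k, i ≠ j → Disjoint (c i).carrier (c j).carrier
  subset : ∀ i, (c i).carrier ⊆ T.carrier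
  centers : T.IsInscribedRegularPolygon (fun i => (c i).center)
  linked_iff : ∀ i j : Fin k, i ≠ j →
    ((c i).IsLinked (c j) ↔
      ((i : ℕ) : ℤ) - ((j : ℕ) : ℤ) ≡ 1 [ZMOD k] ∨ ((j : ℕ) : ℤ) - ((i : ℕ) : ℤ) ≡ 1 [ZMOD k])

/-- A regular simple chain of `2 * m` solid tori, `m ≥ 2`, in the standard solid torus `T`.
Indices start at `0`, so that the first, third, … members of the chain are those with an even
index, and the second, fourth, … members are those with an odd index. -/
structure IsRegularSimpleChain (T : StandardSolidTorus) {m : ℕ}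
    (c : Fin (2 * m) → StandardSolidTorus) : Prop extends T.IsSimpleChain c where
  two_le : 2 ≤ m
  congruent : ∀ i j, (c i).IsCongruent (c j)
  coplanar : ∀ i : Fin (2 * m), Even (i : ℕ) → (c i).plane = T.plane
  /-- The planes are perpendicular, that is, their normal lines are orthogonal. -/
  perpendicular : ∀ i : Fin (2 * m), Odd (i : ℕ) → (c i).plane.directionᗮ ⟂ T.plane.directionᗮ
  /-- The line in which the two planes meet touches the central circle of `T`: this line of the
  plane of the circle has exactly one point in common with the circle. -/
  touches : ∀ i : Fin (2 * m), Odd (i : ℕ) →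
    ∃! p, p ∈ (c i).plane ⊓ T.plane ∧ p ∈ T.centralCircle

end StandardSolidTorus

end

/-! Necessity needs only three consecutive members of one chain. If two disjoint tori are linked,
the central circle of one crosses the flat disk spanned by the other circle, at distance more than
the sum of the small radii from the rim; hence linked copies of `B` have centers closer than `2 *
B.R - 2 * B.r` (`dist_center_lt_of_isLinked`). The first and third members are coplanar and
disjoint, so their centers are more than `2 * (B.R + B.r)` apart (`lt_dist_center_of_plane_eq`). The
triangle inequality gives `3 * B.r < B.R`.

Conversely, `3 * B.r < B.R` makes the interval from `B.R + B.r` to `2 * B.R - 2 * B.r` nonempty. Fix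
its midpoint as the distance of neighbouring centers and put `2 * m` copies of `B` at the vertices
of a regular polygon, alternately horizontal and perpendicular to the radius. As `m` grows the ring
straightens locally, and every requirement becomes a strict inequality that holds at turning angle
`0`, hence for small angles. The radius of the ring tends to infinity, so a torus similar to `B`
around it becomes thick enough to contain all members; one construction thus serves (2) and (3).

That neighbours are linked is the topological point. The complement of a circle maps to the
punctured plane by (radial coordinate, height). A contractible loop would have an image with a
continuous square root, by lifting through `z ↦ z ^ 2`; a loop that passes once inside and once
outside the circle has none (`no_sqrt_of_winding`, `isLinked_of_crossing`). -/

noncomputable section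

open Real Metric Filter Topology

/-! ### Orthonormal frames of space -/

theorem exists_unit_orthogonal (a b : E3) :
    ∃ f : E3, ‖f‖ = 1 ∧ inner ℝ a f = 0 ∧ inner ℝ b f = 0 := by
  have hr : Module.finrank ℝ (Submodule.span ℝ {a, b}) ≤ 2 := by
    have h := finrank_span_finset_le_card (R := ℝ) ({a, b} : Finset E3)
    have h2 : ({a, b} : Finset E3).card ≤ 2 := Finset.card_le_two
    simp only [Finset.coe_insert, Finset.coe_singleton] at h
    exact h.trans h2
  have hne : (Submodule.span ℝ {a, b})ᗮ ≠ ⊥ := by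
    intro h
    have h3 := (Submodule.span ℝ {a, b}).finrank_add_finrank_orthogonal
    rw [h, finrank_bot, finrank_euclideanSpace, Fintype.card_fin] at h3
    omega
  obtain ⟨z, hz, hz0⟩ := Submodule.exists_mem_ne_zero_of_ne_bot hne
  rw [Submodule.mem_orthogonal] at hz
  refine ⟨‖z‖⁻¹ • z, norm_smul_inv_norm hz0, ?_, ?_⟩ <;>
    rw [inner_smul_right, hz _ (Submodule.subset_span (by simp)), mul_zero]

/-- Three pairwise orthogonal unit vectors of space. -/
structure IsFrame (u v w : E3) : Prop where
  norm_fst : ‖u‖ = 1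
  norm_snd : ‖v‖ = 1
  norm_thd : ‖w‖ = 1
  inner_fst_snd : inner ℝ u v = 0
  inner_fst_thd : inner ℝ u w = 0
  inner_snd_thd : inner ℝ v w = 0

theorem IsFrame.eq_sum {u v w : E3} (h : IsFrame u v w) (x : E3) :
    x = inner ℝ u x • u + inner ℝ v x • v + inner ℝ w x • w := by
  have ho : Orthonormal ℝ ![u, v, w] := by
    rw [orthonormal_iff_ite]
    intro i j
    fin_cases i <;> fin_cases j <;>
      simp [h.norm_fst, h.norm_snd, h.norm_thd, h.inner_fst_snd, h.inner_fst_thd, h.inner_snd_thd,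
        real_inner_comm u v, real_inner_comm u w, real_inner_comm v w]
  have hs : ⊤ ≤ Submodule.span ℝ (Set.range ![u, v, w]) := by
    rw [ho.linearIndependent.span_eq_top_of_card_eq_finrank (by simp)]
  have := (OrthonormalBasis.mk ho hs).sum_repr' x
  simpa [Fin.sum_univ_three] using this.symm

theorem norm_sq_add_smul {u v : E3} (hu : ‖u‖ = 1) (hv : ‖v‖ = 1) (huv : inner ℝ u v = 0)
    (s t : ℝ) : ‖s • u + t • v‖ ^ 2 = s ^ 2 + t ^ 2 := by
  rw [norm_add_sq_real, norm_smul, norm_smul, inner_smul_left, inner_smul_right, huv, hu, hv]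
  simp

namespace StandardSolidTorus

/-! ### Metric description of a solid torus -/

theorem R_pos (T : StandardSolidTorus) : 0 < T.R := T.r_pos.trans T.r_lt_R

theorem mem_centralCircle {T : StandardSolidTorus} {x : E3} :
    x ∈ T.centralCircle ↔ inner ℝ T.axis (x - T.center) = 0 ∧ dist x T.center = T.R := Iff.rfl

theorem center_add_smul_mem_centralCircle (T : StandardSolidTorus) {f : E3} (hf : ‖f‖ = 1)
    (ha : inner ℝ T.axis f = 0) : T.center + T.R • f ∈ T.centralCircle := by
  refine ⟨?_, ?_⟩
  · rw [add_sub_cancel_left, inner_smul_right, ha, mul_zero]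
  · rw [dist_eq_norm, add_sub_cancel_left, norm_smul, hf, mul_one, norm_of_nonneg T.R_pos.le]

theorem exists_unit_horizontal (T : StandardSolidTorus) {v : E3} (hv : inner ℝ T.axis v = 0) :
    ∃ f : E3, ‖f‖ = 1 ∧ inner ℝ T.axis f = 0 ∧ v = ‖v‖ • f := by
  by_cases h : v = 0
  · obtain ⟨f, hf, haf, -⟩ := exists_unit_orthogonal T.axis T.axis
    exact ⟨f, hf, haf, by simp [h]⟩
  · refine ⟨‖v‖⁻¹ • v, norm_smul_inv_norm h, by rw [inner_smul_right, hv, mul_zero], ?_⟩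
    rw [smul_smul, mul_inv_cancel₀ (norm_ne_zero_iff.2 h), one_smul]

/-- The component of `x - T.center` orthogonal to the axis. -/
def planar (T : StandardSolidTorus) (x : E3) : E3 :=
  (x - T.center) - (inner ℝ T.axis (x - T.center) : ℝ) • T.axis

theorem inner_axis_planar (T : StandardSolidTorus) (x : E3) : inner ℝ T.axis (T.planar x) = 0 := by
  rw [planar, inner_sub_right, inner_smul_right, real_inner_self_eq_norm_sq, T.norm_axis]
  ring

theorem eq_center_add (T : StandardSolidTorus) (x : E3) :
    x = T.center + (inner ℝ T.axis (x - T.center) : ℝ) • T.axis + T.planar x := by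
  rw [planar]; abel

/-- The condition that the disk lie in a meridian plane is redundant: the point of the central
circle nearest to `x` lies in the meridian half-plane through `x`. This makes the torus a metric
neighbourhood of its circle. -/
theorem mem_carrier {T : StandardSolidTorus} {x : E3} :
    x ∈ T.carrier ↔ ∃ p ∈ T.centralCircle, dist x p ≤ T.r := by
  simp only [carrier, meridianDisk, Set.mem_iUnion, Set.mem_ofPred_eq, exists_prop]
  constructor
  · rintro ⟨p, hp, h, -⟩
    exact ⟨p, hp, h⟩
  rintro ⟨p, hp, hxp⟩
  obtain ⟨f, hf, haf, hvf⟩ := T.exists_unit_horizontal (T.inner_axis_planar x)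
  set h : ℝ := inner ℝ T.axis (x - T.center) with hh
  set t := ‖T.planar x‖ with ht
  have hx : x = T.center + h • T.axis + t • f := by rw [← hvf]; exact T.eq_center_add x
  refine ⟨T.center + T.R • f, T.center_add_smul_mem_centralCircle hf haf, ?_, ?_⟩
  · refine le_trans ?_ hxp
    have h1 : dist x (T.center + T.R • f) ^ 2 = h ^ 2 + (t - T.R) ^ 2 := by
      rw [dist_eq_norm, ← norm_sq_add_smul T.norm_axis hf haf]
      congr 2
      rw [hx]; module
    have h2 : dist x p ^ 2 = h ^ 2 + t ^ 2 + T.R ^ 2 - 2 * (t * inner ℝ f (p - T.center)) := by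
      have : x - p = (h • T.axis + t • f) - (p - T.center) := by rw [hx]; abel
      rw [dist_eq_norm, this, norm_sub_sq_real, norm_sq_add_smul T.norm_axis hf haf,
        ← dist_eq_norm, hp.2, inner_add_left, inner_smul_left, inner_smul_left, hp.1]
      simp
      ring
    have h3 : inner ℝ f (p - T.center) ≤ T.R := by
      have := real_inner_le_norm f (p - T.center)
      rwa [hf, one_mul, ← dist_eq_norm, hp.2] at this
    have h4 : 0 ≤ t := norm_nonneg _
    refine le_of_sq_le_sq ?_ dist_nonneg
    rw [h1, h2]
    nlinarith [mul_le_mul_of_nonneg_left h3 h4]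
  · set Q := affineSpan ℝ {T.center, T.center + T.axis, T.center + T.R • f}
    have hc : T.center ∈ Q := subset_affineSpan ℝ _ (by simp)
    have hca : T.center + T.axis ∈ Q := subset_affineSpan ℝ _ (by simp)
    have hcf : T.center + T.R • f ∈ Q := subset_affineSpan ℝ _ (by simp)
    have h1 := Q.smul_vsub_vadd_mem h hca hc hc
    have h2 := Q.smul_vsub_vadd_mem (t / T.R) hcf hc h1
    convert h2 using 1
    simp only [vsub_eq_sub, vadd_eq_add, add_sub_cancel_left, smul_smul,
      div_mul_cancel₀ t T.R_pos.ne']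
    rw [hx]; abel

theorem dist_center_le {T : StandardSolidTorus} {x : E3} (hx : x ∈ T.carrier) :
    dist x T.center ≤ T.R + T.r := by
  obtain ⟨p, hp, h⟩ := mem_carrier.1 hx
  linarith [dist_triangle x p T.center, hp.2]

theorem abs_height_le {T : StandardSolidTorus} {x : E3} (hx : x ∈ T.carrier) :
    |inner ℝ T.axis (x - T.center)| ≤ T.r := by
  obtain ⟨p, hp, h⟩ := mem_carrier.1 hx
  have h1 : inner ℝ T.axis (x - T.center) = inner ℝ T.axis (x - p) := by
    rw [← sub_add_sub_cancel x p T.center, inner_add_right, hp.1, add_zero]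
  rw [h1]
  refine (abs_real_inner_le_norm _ _).trans ?_
  rwa [T.norm_axis, one_mul, ← dist_eq_norm]

theorem center_add_smul_mem_carrier (T : StandardSolidTorus) {f : E3} (hf : ‖f‖ = 1)
    (ha : inner ℝ T.axis f = 0) : T.center + (T.R + T.r) • f ∈ T.carrier := by
  refine mem_carrier.2 ⟨_, T.center_add_smul_mem_centralCircle hf ha, ?_⟩
  rw [dist_eq_norm, add_smul, ← add_assoc, add_sub_cancel_left, norm_smul, hf, mul_one,
    norm_of_nonneg T.r_pos.le]

theorem disjoint_carrier_iff {S T : StandardSolidTorus} : Disjoint S.carrier T.carrier ↔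
    ∀ x ∈ S.centralCircle, ∀ y ∈ T.centralCircle, S.r + T.r < dist x y := by
  rw [Set.disjoint_left]
  constructor
  · intro h x hx y hy
    by_contra! hle
    have hp : 0 < S.r + T.r := add_pos S.r_pos T.r_pos
    -- Dividing the segment in the ratio of the small radii gives a common point of both tori.
    set z := AffineMap.lineMap x y (S.r / (S.r + T.r)) with hz
    refine h (a := z) (mem_carrier.2 ⟨x, hx, ?_⟩) (mem_carrier.2 ⟨y, hy, ?_⟩)
    · rw [hz, dist_lineMap_left, norm_of_nonneg (div_nonneg S.r_pos.le hp.le), div_mul_eq_mul_div,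
        div_le_iff₀ hp]
      exact mul_le_mul_of_nonneg_left hle S.r_pos.le
    · have : 1 - S.r / (S.r + T.r) = T.r / (S.r + T.r) := by field_simp; ring
      rw [hz, dist_lineMap_right, this, norm_of_nonneg (div_nonneg T.r_pos.le hp.le),
        div_mul_eq_mul_div, div_le_iff₀ hp]
      exact mul_le_mul_of_nonneg_left hle T.r_pos.le
  · intro h z hzS hzT
    obtain ⟨x, hx, hzx⟩ := mem_carrier.1 hzS
    obtain ⟨y, hy, hzy⟩ := mem_carrier.1 hzT
    linarith [h x hx y hy, dist_triangle_left x y z]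

theorem center_mem_plane (T : StandardSolidTorus) : T.center ∈ T.plane := by
  obtain ⟨f, hf, haf, -⟩ := exists_unit_orthogonal T.axis T.axis
  have h1 := subset_affineSpan ℝ _ (T.center_add_smul_mem_centralCircle hf haf)
  have h2 := subset_affineSpan ℝ _ (T.center_add_smul_mem_centralCircle (f := -f)
    (by rwa [norm_neg]) (by rw [inner_neg_right, haf, neg_zero]))
  have h3 := T.plane.smul_vsub_vadd_mem (1 / 2 : ℝ) h1 h2 h2
  convert h3 using 1
  simp only [vsub_eq_sub, vadd_eq_add]
  module

theorem mem_plane {T : StandardSolidTorus} {x : E3} :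
    x ∈ T.plane ↔ inner ℝ T.axis (x - T.center) = 0 := by
  constructor
  · intro hx
    have hle : T.plane ≤ AffineSubspace.mk' T.center (ℝ ∙ T.axis)ᗮ := by
      refine affineSpan_le.2 fun y hy => ?_
      rw [SetLike.mem_coe, AffineSubspace.mem_mk', Submodule.mem_orthogonal_singleton_iff_inner_right]
      exact hy.1
    have := hle hx
    rwa [AffineSubspace.mem_mk', Submodule.mem_orthogonal_singleton_iff_inner_right] at this
  · intro hx
    obtain ⟨f, hf, haf, hxf⟩ := T.exists_unit_horizontal hx
    have h1 : T.center + T.R • f ∈ T.plane :=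
      subset_affineSpan ℝ _ (T.center_add_smul_mem_centralCircle hf haf)
    have h3 := T.plane.smul_vsub_vadd_mem (‖x - T.center‖ / T.R) h1 T.center_mem_plane
      T.center_mem_plane
    convert h3 using 1
    simp only [vsub_eq_sub, vadd_eq_add, add_sub_cancel_left, smul_smul,
      div_mul_cancel₀ _ T.R_pos.ne']
    rw [← hxf]; abel

theorem plane_eq_mk' (T : StandardSolidTorus) :
    T.plane = AffineSubspace.mk' T.center (ℝ ∙ T.axis)ᗮ := by
  ext x
  rw [mem_plane, AffineSubspace.mem_mk', Submodule.mem_orthogonal_singleton_iff_inner_right]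
  rfl

/-! ### Congruence and similarity -/

theorem image_carrier_eq {S T : StandardSolidTorus} {k : ℝ} (hk : 0 < k) (f : E3 → E3)
    (hsurj : Function.Surjective f) (hf : ∀ x y, dist (f x) (f y) = k * dist x y)
    (hC : ∀ x, f x ∈ T.centralCircle ↔ x ∈ S.centralCircle) (hr : T.r = k * S.r) :
    f '' S.carrier = T.carrier := by
  have key : ∀ x, f x ∈ T.carrier ↔ x ∈ S.carrier := by
    intro x
    rw [mem_carrier, mem_carrier]
    constructor
    · rintro ⟨p, hp, h⟩
      obtain ⟨q, rfl⟩ := hsurj p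
      refine ⟨q, (hC q).1 hp, ?_⟩
      rw [hf, hr] at h
      exact le_of_mul_le_mul_left h hk
    · rintro ⟨p, hp, h⟩
      refine ⟨f p, (hC p).2 hp, ?_⟩
      rw [hf, hr]
      exact mul_le_mul_of_nonneg_left h hk.le
  ext y
  constructor
  · rintro ⟨x, hx, rfl⟩
    exact (key x).2 hx
  · intro hy
    obtain ⟨x, rfl⟩ := hsurj y
    exact ⟨x, (key x).1 hy, rfl⟩

theorem isCongruent_of_eq {S T : StandardSolidTorus} (hR : S.R = T.R) (hr : S.r = T.r) :
    S.IsCongruent T := by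
  let g : E3 ≃ₗᵢ[ℝ] E3 := (ℝ ∙ (S.axis - T.axis))ᗮ.reflection
  have hg : g S.axis = T.axis := Submodule.reflection_sub (S.norm_axis.trans T.norm_axis.symm)
  let f : E3 ≃ᵢ E3 :=
    ((IsometryEquiv.subRight S.center).trans g.toIsometryEquiv).trans
      (IsometryEquiv.addRight T.center)
  have hfx : ∀ x, f x = g (x - S.center) + T.center := fun x => rfl
  refine ⟨f, image_carrier_eq one_pos f f.surjective (fun x y => ?_) (fun x => ?_) ?_⟩
  · rw [one_mul, f.dist_eq]
  · rw [mem_centralCircle, mem_centralCircle, hfx, add_sub_cancel_right, ← hg,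
      g.inner_map_map, dist_eq_norm, add_sub_cancel_right, g.norm_map, ← dist_eq_norm, hR]
  · rw [one_mul, hr]

theorem isSimilar_of_eq {S T : StandardSolidTorus} {k : ℝ} (hk : 0 < k) (hS : S.center = 0)
    (ha : S.axis = T.axis) (hR : T.R = k * S.R) (hr : T.r = k * S.r) : S.IsSimilar T := by
  let f : E3 ≃ᵈ E3 := DilationEquiv.smulTorsor T.center hk.ne'
  have hfx : ∀ x, f x = k • x + T.center := fun x => rfl
  refine ⟨f, image_carrier_eq hk f f.surjective (fun x y => ?_) (fun x => ?_) hr⟩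
  · rw [hfx, hfx, dist_add_right, dist_smul₀, norm_of_nonneg hk.le]
  · rw [mem_centralCircle, mem_centralCircle, hfx, add_sub_cancel_right, dist_eq_norm,
      add_sub_cancel_right, norm_smul, inner_smul_right, hS, sub_zero, dist_zero_right, ha, hR,
      norm_of_nonneg hk.le, mul_right_inj' hk.ne', mul_eq_zero, or_iff_right hk.ne']

/-- The torus lies in a slab of width `2 * T.r`. Hence `r` is the largest radius of a ball inside,
which makes it an invariant of the point set. -/
theorem le_r_of_closedBall_subset {T : StandardSolidTorus} {x : E3} {s : ℝ} (hs : 0 ≤ s)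
    (h : closedBall x s ⊆ T.carrier) : s ≤ T.r := by
  have hb : ∀ t : ℝ, |t| = s →
      |inner ℝ T.axis (x - T.center) + t| ≤ T.r := by
    intro t ht
    have : x + t • T.axis ∈ closedBall x s := by
      rw [mem_closedBall, dist_eq_norm, add_sub_cancel_left, norm_smul, T.norm_axis, mul_one,
        norm_eq_abs, ht]
    have := abs_height_le (h this)
    rwa [add_sub_right_comm, inner_add_right, inner_smul_right, real_inner_self_eq_norm_sq,
      T.norm_axis, one_pow, mul_one] at this
  have h1 := (abs_le.1 (hb s (abs_of_nonneg hs))).2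
  have h2 := (abs_le.1 (hb (-s) (by rw [abs_neg, abs_of_nonneg hs]))).1
  linarith

theorem IsCongruent.symm {S T : StandardSolidTorus} (h : S.IsCongruent T) : T.IsCongruent S := by
  obtain ⟨f, hf⟩ := h
  refine ⟨f.symm, ?_⟩
  rw [← hf, ← Set.image_comp]
  simp

theorem IsCongruent.r_le {S T : StandardSolidTorus} (h : S.IsCongruent T) : S.r ≤ T.r := by
  obtain ⟨f, hf⟩ := h
  obtain ⟨u, hu, hau, -⟩ := exists_unit_orthogonal S.axis S.axis
  have h1 : closedBall (S.center + S.R • u) S.r ⊆ S.carrier := fun x hx =>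
    mem_carrier.2 ⟨_, S.center_add_smul_mem_centralCircle hu hau, hx⟩
  refine le_r_of_closedBall_subset (x := f (S.center + S.R • u)) S.r_pos.le ?_
  rw [← f.image_closedBall, ← hf]
  exact Set.image_mono h1

/-- The diameter of the point set is `2 * (R + r)`; together with the invariance of `r` this
recovers `R`. -/
theorem IsCongruent.R_add_r_le {S T : StandardSolidTorus} (h : S.IsCongruent T) :
    S.R + S.r ≤ T.R + T.r := by
  obtain ⟨f, hf⟩ := h
  obtain ⟨u, hu, hau, -⟩ := exists_unit_orthogonal S.axis S.axis
  have h1 := S.center_add_smul_mem_carrier hu hau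
  have h2 := S.center_add_smul_mem_carrier (f := -u) (by rwa [norm_neg])
    (by rw [inner_neg_right, hau, neg_zero])
  have h3 : dist (S.center + (S.R + S.r) • u) (S.center + (S.R + S.r) • -u) =
      2 * (S.R + S.r) := by
    have : S.center + (S.R + S.r) • u - (S.center + (S.R + S.r) • -u) =
        (2 * (S.R + S.r)) • u := by module
    rw [dist_eq_norm, this, norm_smul, hu, mul_one, norm_of_nonneg]
    linarith [S.R_pos, S.r_pos]
  have h4 := dist_center_le (hf ▸ Set.mem_image_of_mem f h1 : f _ ∈ T.carrier)
  have h5 := dist_center_le (hf ▸ Set.mem_image_of_mem f h2 : f _ ∈ T.carrier)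
  have h6 := f.dist_eq (S.center + (S.R + S.r) • u) (S.center + (S.R + S.r) • -u)
  linarith [dist_triangle_right (f (S.center + (S.R + S.r) • u))
    (f (S.center + (S.R + S.r) • -u)) T.center]

theorem IsCongruent.r_eq {S T : StandardSolidTorus} (h : S.IsCongruent T) : S.r = T.r :=
  le_antisymm h.r_le h.symm.r_le

theorem IsCongruent.R_eq {S T : StandardSolidTorus} (h : S.IsCongruent T) : S.R = T.R := by
  linarith [h.R_add_r_le, h.symm.R_add_r_le, h.r_eq]

/-! ### A torus not meeting the disk of another one -/

/-- Otherwise the circle of `S` contracts radially to its center within its flat disk, missing the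
circle of `T`. -/
theorem exists_mem_disk_of_isLinked {S T : StandardSolidTorus} (h : S.IsLinked T) :
    ∃ z ∈ T.centralCircle, inner ℝ S.axis (z - S.center) = 0 ∧ dist z S.center ≤ S.R := by
  by_contra! hno
  obtain ⟨hsub, hnull⟩ := h
  have hmem : ∀ (t : unitInterval) (x : S.centralCircle),
      AffineMap.lineMap (x : E3) S.center (t : ℝ) ∈ T.centralCircleᶜ := by
    intro t x hz
    have hv : AffineMap.lineMap (x : E3) S.center (t : ℝ) - S.center =
        (1 - (t : ℝ)) • ((x : E3) - S.center) := by
      rw [AffineMap.lineMap_apply_module]; module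
    refine absurd (hno _ hz (by rw [hv, inner_smul_right, x.2.1, mul_zero])) (not_lt.2 ?_)
    rw [dist_eq_norm, hv, norm_smul, norm_of_nonneg (sub_nonneg.2 t.2.2), ← dist_eq_norm,
      x.2.2]
    exact mul_le_of_le_one_left S.R_pos.le (by linarith [t.2.1])
  obtain ⟨f, hf, haf, -⟩ := exists_unit_orthogonal S.axis S.axis
  let x₀ : S.centralCircle := ⟨_, S.center_add_smul_mem_centralCircle hf haf⟩
  refine hnull ⟨⟨S.center, by simpa using hmem 1 x₀⟩, ⟨⟨⟨fun p => ⟨_, hmem p.1 p.2⟩, ?_⟩, ?_, ?_⟩⟩⟩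
  · refine Continuous.subtype_mk ?_ _
    simp only [AffineMap.lineMap_apply_module]
    fun_prop
  · intro x
    ext1
    simp [Set.inclusion]
  · intro x
    ext1
    simp

theorem dist_center_lt_of_isLinked {S T : StandardSolidTorus} (h : S.IsLinked T)
    (hd : Disjoint S.carrier T.carrier) :
    dist S.center T.center < S.R + T.R - (S.r + T.r) := by
  obtain ⟨z, hz, hperp, hle⟩ := exists_mem_disk_of_isLinked h
  obtain ⟨f, hf, haf, hzf⟩ := S.exists_unit_horizontal hperp
  -- The point of the circle of `S` on the ray through `z` is at distance `S.R - dist z S.center`,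
  -- so disjointness keeps `z` away from the rim.
  have h1 := disjoint_carrier_iff.1 hd _ (S.center_add_smul_mem_centralCircle hf haf) z hz
  have h2 : S.center + S.R • f - z = (S.R - dist z S.center) • f := by
    rw [sub_smul, dist_eq_norm, ← hzf]; abel
  rw [dist_eq_norm, h2, norm_smul, hf, mul_one, norm_of_nonneg (sub_nonneg.2 hle)] at h1
  have h3 := dist_triangle_left S.center T.center z
  rw [hz.2] at h3
  linarith

/-- Otherwise the two outer equators, coplanar circles of radius `R + r`, meet on the perpendicular
bisector of the centers, at height `s` over the midpoint. -/
theorem lt_dist_center_of_plane_eq {S T : StandardSolidTorus} (hp : S.plane = T.plane)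
    (hR : S.R = T.R) (hr : S.r = T.r) (hd : Disjoint S.carrier T.carrier) :
    2 * (S.R + S.r) < dist S.center T.center := by
  by_contra! hle
  obtain ⟨v, hv⟩ : ∃ v : E3, v = (1 / 2 : ℝ) • (T.center - S.center) := ⟨_, rfl⟩
  obtain ⟨f, hf, haf, hvf⟩ := exists_unit_orthogonal S.axis v
  have hSv : inner ℝ S.axis v = 0 := by
    rw [hv, inner_smul_right, mem_plane.1 (hp ▸ T.center_mem_plane), mul_zero]
  have hTv : inner ℝ T.axis v = 0 := by
    rw [hv, ← neg_sub, smul_neg, inner_neg_right, inner_smul_right,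
      mem_plane.1 (hp ▸ S.center_mem_plane), mul_zero, neg_zero]
  have hTf : inner ℝ T.axis f = 0 := by
    have h1 : S.center + f ∈ S.plane := mem_plane.2 (by rwa [add_sub_cancel_left])
    rw [hp, mem_plane] at h1
    have h2 : f = (S.center + f - T.center) + (2 : ℝ) • v := by rw [hv]; module
    rw [h2, inner_add_right, h1, inner_smul_right, hTv]
    simp
  have hvn : ‖v‖ ≤ S.R + S.r := by
    rw [hv, norm_smul, ← dist_eq_norm, dist_comm]
    norm_num
    linarith
  have hpos : 0 < S.R + S.r := add_pos S.R_pos S.r_pos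
  set s := √((S.R + S.r) ^ 2 - ‖v‖ ^ 2) with hs
  have hs2 : s ^ 2 = (S.R + S.r) ^ 2 - ‖v‖ ^ 2 :=
    Real.sq_sqrt (sub_nonneg.2 (pow_le_pow_left₀ (norm_nonneg _) hvn 2))
  have mem : ∀ (U : StandardSolidTorus) (w : E3), U.R + U.r = S.R + S.r → inner ℝ U.axis w = 0 →
      ‖w‖ ^ 2 = (S.R + S.r) ^ 2 → U.center + w ∈ U.carrier := by
    intro U w hU haw hw
    obtain ⟨e, he, hae, hwe⟩ := U.exists_unit_horizontal haw
    have : ‖w‖ = U.R + U.r := by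
      rw [hU]; exact (pow_left_inj₀ (norm_nonneg _) hpos.le two_ne_zero).1 hw
    rw [hwe, this]
    exact U.center_add_smul_mem_carrier he hae
  have hn : ∀ ε : ℝ, ε ^ 2 = 1 → ‖ε • v + s • f‖ ^ 2 = (S.R + S.r) ^ 2 := by
    intro ε hε
    rw [norm_add_sq_real, inner_smul_left, inner_smul_right, hvf, norm_smul, norm_smul, hf,
      mul_pow, mul_pow, norm_eq_abs, norm_eq_abs, sq_abs, sq_abs, hs2, hε]
    simp
  refine Set.disjoint_left.1 hd
    (mem S ((1 : ℝ) • v + s • f) rfl ?_ (hn 1 (by norm_num))) ?_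
  · rw [inner_add_right, inner_smul_right, inner_smul_right, hSv, haf]; simp
  · have h3 : S.center + ((1 : ℝ) • v + s • f) = T.center + ((-1 : ℝ) • v + s • f) := by
      rw [hv]; module
    rw [h3]
    refine mem T _ (by rw [hR, hr]) ?_ (hn (-1) (by norm_num))
    rw [inner_add_right, inner_smul_right, inner_smul_right, hTv, hTf]; simp

theorem IsRegularSimpleChain.three_mul_r_lt {T B : StandardSolidTorus} {m : ℕ}
    {c : Fin (2 * m) → StandardSolidTorus} (h : T.IsRegularSimpleChain c)
    (hB : ∀ i, (c i).IsCongruent B) : 3 * B.r < B.R := by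
  have hm := h.two_le
  let i₀ : Fin (2 * m) := ⟨0, by omega⟩
  let i₁ : Fin (2 * m) := ⟨1, by omega⟩
  let i₂ : Fin (2 * m) := ⟨2, by omega⟩
  have h01 : i₀ ≠ i₁ := by simp [i₀, i₁]
  have h21 : i₂ ≠ i₁ := by simp [i₂, i₁]
  have h02 : i₀ ≠ i₂ := by simp [i₀, i₂]
  have l01 := (h.linked_iff i₀ i₁ h01).2 (Or.inr (by simp [i₀, i₁]))
  have l21 := (h.linked_iff i₂ i₁ h21).2 (Or.inl (by simp [i₂, i₁]))
  have d01 := dist_center_lt_of_isLinked l01 (h.disjoint _ _ h01)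
  have d21 := dist_center_lt_of_isLinked l21 (h.disjoint _ _ h21)
  have d02 := lt_dist_center_of_plane_eq
    ((h.coplanar i₀ (by simp [i₀])).trans (h.coplanar i₂ (by simp [i₂])).symm)
    ((hB i₀).R_eq.trans (hB i₂).R_eq.symm) ((hB i₀).r_eq.trans (hB i₂).r_eq.symm)
    (h.disjoint _ _ h02)
  rw [(hB _).R_eq, (hB _).R_eq, (hB _).r_eq, (hB _).r_eq] at d01 d21
  rw [(hB _).R_eq, (hB _).r_eq] at d02
  linarith [dist_triangle_right (c i₀).center (c i₂).center (c i₁).center]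

end StandardSolidTorus

/-! ### Square roots of nullhomotopic maps into the punctured plane -/

theorem ContinuousMap.Nullhomotopic.exists_sq_eq {X : Type*} [TopologicalSpace X]
    {f : C(X, {z : ℂ // z ≠ 0})} (hf : f.Nullhomotopic) :
    ∃ s : C(X, ℂ), ∀ x, s x ^ 2 = (f x : ℂ) := by
  obtain ⟨y, hy⟩ := hf
  obtain ⟨H⟩ := hy.symm
  have cov := isCoveringMap_npow (𝕜 := ℂ) 2 (by norm_num)
  obtain ⟨w, hw⟩ := IsAlgClosed.exists_pow_nat_eq (y : ℂ) two_pos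
  have hw0 : w ≠ 0 := by
    rintro rfl
    exact y.2 (by rw [← hw]; simp)
  have hH0 : ∀ x : X, H (0, x) = ⟨w ^ 2, pow_ne_zero 2 hw0⟩ := fun x => by
    rw [H.apply_zero, ContinuousMap.const_apply]
    exact Subtype.ext hw.symm
  -- The homotopy runs from the constant to `f`, so its lift can start at the constant square root
  -- `w`; its end is a root of `f`.
  let G := cov.liftHomotopy H.toContinuousMap (ContinuousMap.const X ⟨w, hw0⟩) hH0
  refine ⟨⟨fun x => (G (1, x) : ℂ), by fun_prop⟩, fun x => ?_⟩
  have h := congrFun (cov.liftHomotopy_lifts H.toContinuousMap (ContinuousMap.const X ⟨w, hw0⟩) hH0)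
    (1, x)
  have h1 : H (1, x) = f x := H.apply_one x
  exact (congrArg Subtype.val h).trans (congrArg Subtype.val h1)

/-- A loop in the punctured plane that crosses the real axis from the negative to the positive
side through the upper half-plane and returns through the lower one has no continuous square
root. -/
theorem no_sqrt_of_winding {s : ℝ → ℂ} (hs : Continuous s) {a b c : ℝ} (hab : a ≤ b) (hbc : b ≤ c)
    (hper : s c = s a) (h0 : ∀ t, s t ≠ 0)
    (hup : ∀ t ∈ Set.Icc a b, 0 ≤ (s t ^ 2).im) (hlow : ∀ t ∈ Set.Icc b c, (s t ^ 2).im ≤ 0)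
    (ha : (s a ^ 2).re < 0) (ha' : (s a ^ 2).im = 0)
    (hb : 0 < (s b ^ 2).re) (hb' : (s b ^ 2).im = 0) : False := by
  have hre : ∀ z : ℂ, (z ^ 2).re = z.re ^ 2 - z.im ^ 2 := fun z => by
    simp [pow_two]
  have him : ∀ z : ℂ, (z ^ 2).im = 2 * (z.re * z.im) := fun z => by
    simp [pow_two]; ring
  simp only [hre, him] at *
  have hcre : Continuous fun t => (s t).re := Complex.continuous_re.comp hs
  have hcim : Continuous fun t => (s t).im := Complex.continuous_im.comp hs
  have hne : ∀ t, (s t).re ≠ 0 ∨ (s t).im ≠ 0 := by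
    intro t
    by_contra! h
    exact h0 t (Complex.ext h.1 h.2)
  have ha0 : (s a).re = 0 := by
    rcases mul_eq_zero.1 ((mul_eq_zero.1 ha').resolve_left two_ne_zero) with h | h
    · exact h
    · rw [h] at ha; nlinarith [sq_nonneg (s a).re]
  have hb0 : (s b).im = 0 := by
    rcases mul_eq_zero.1 ((mul_eq_zero.1 hb').resolve_left two_ne_zero) with h | h
    · rw [h] at hb; nlinarith [sq_nonneg (s b).im]
    · exact h
  have key : ∀ (g : ℝ → ℝ) (p q : ℝ), Continuous g → p ≤ q → (∀ t ∈ Set.Icc p q, g t ≠ 0) →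
      0 < g p * g q := by
    intro g p q hg hpq hgt
    by_contra! hle
    have h0 : (0 : ℝ) ∈ Set.uIcc (g p) (g q) := by
      rw [Set.mem_uIcc]
      rcases mul_nonpos_iff.1 hle with h | h
      · exact Or.inr ⟨h.2, h.1⟩
      · exact Or.inl h
    obtain ⟨t, ht, hgt0⟩ := intermediate_value_uIcc hg.continuousOn h0
    rw [Set.uIcc_of_le hpq] at ht
    exact hgt t ht hgt0
  -- While the square stays in the closed upper half-plane, `s` cannot cross the line `re + im = 0`;
  -- in the lower one it cannot cross `re = im`. As `s a` is imaginary and `s b` real, the first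
  -- fact makes `(s a).im` and `(s b).re` of equal sign, the second of opposite sign.
  have h1 := key (fun t => (s t).re + (s t).im) a b (by fun_prop) hab (fun t ht h => by
    have h2 := hup t ht
    have h3 : (s t).re = -(s t).im := by linarith
    rw [h3] at h2
    have h4 : (s t).im = 0 := by nlinarith
    rcases hne t with h5 | h5
    · exact h5 (by rw [h3, h4, neg_zero])
    · exact h5 h4)
  have h2 := key (fun t => (s t).re - (s t).im) b c (by fun_prop) hbc (fun t ht h => by
    have h2 := hlow t ht
    have h3 : (s t).re = (s t).im := by linarith
    rw [h3] at h2
    have h4 : (s t).im = 0 := by nlinarith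
    rcases hne t with h5 | h5
    · exact h5 (by rw [h3, h4])
    · exact h5 h4)
  simp only [hper, ha0, hb0] at h1 h2
  linarith

theorem sin_le_sin_of_mem_Icc {α β : ℝ} (hα : -(π / 2) ≤ α) (hβ : β ∈ Set.Icc α (π - α)) :
    sin α ≤ sin β := by
  rw [← sub_nonneg, sin_sub_sin]
  refine mul_nonneg (mul_nonneg two_pos.le (sin_nonneg_of_mem_Icc ⟨?_, ?_⟩))
    (cos_nonneg_of_mem_Icc ⟨?_, ?_⟩) <;> linarith [hβ.1, hβ.2]

theorem sin_le_sin_of_mem_Icc' {α β : ℝ} (hα : α ≤ π / 2)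
    (hβ : β ∈ Set.Icc (π - α) (α + 2 * π)) : sin β ≤ sin α := by
  rw [← sub_nonpos, sin_sub_sin]
  refine mul_nonpos_of_nonneg_of_nonpos (mul_nonneg two_pos.le (sin_nonneg_of_mem_Icc ⟨?_, ?_⟩))
    (cos_nonpos_of_pi_div_two_le_of_le ?_ ?_) <;> linarith [hβ.1, hβ.2]

/-! ### A linking criterion for perpendicular circles. -/

namespace StandardSolidTorus

/-- Maps the complement of the central circle to the punctured plane: the meridian half-plane
through a point, punctured at the circle, with its distance coordinate squared. -/
def meridianMap (T : StandardSolidTorus) : C((T.centralCircleᶜ : Set E3), {z : ℂ // z ≠ 0}) where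
  toFun x := ⟨⟨‖T.planar x‖ ^ 2 - T.R ^ 2, inner ℝ T.axis ((x : E3) - T.center)⟩, by
    intro h
    have h1 : ‖T.planar x‖ ^ 2 - T.R ^ 2 = 0 := congrArg Complex.re h
    have h2 : inner ℝ T.axis ((x : E3) - T.center) = 0 := congrArg Complex.im h
    refine x.2 ⟨h2, ?_⟩
    rw [planar, h2, zero_smul, sub_zero, sub_eq_zero] at h1
    rw [dist_eq_norm]
    exact (pow_left_inj₀ (norm_nonneg _) T.R_pos.le two_ne_zero).1 h1⟩
  continuous_toFun := by
    refine Continuous.subtype_mk ?_ _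
    have hp : Continuous T.planar := by unfold planar; fun_prop
    exact Complex.equivRealProdCLM.symm.continuous.comp
      ((((hp.comp continuous_subtype_val).norm.pow 2).sub continuous_const).prodMk
        (continuous_const.inner (continuous_subtype_val.sub continuous_const)))

/-- The circle of `A` meets the plane of `B` in two points, with `e`-coordinates `s - k` and `-s -
k` from the center of `B`; `hin` puts the first inside the circle of `B`, `hout` the second outside.
Between them the height has constant sign on each arc, so the image under `meridianMap` winds once
around `0`. -/
theorem isLinked_of_crossing {A B : StandardSolidTorus} (hd : A.centralCircle ⊆ B.centralCircleᶜ)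
    {e : E3} (hf : IsFrame e B.axis A.axis) {k h l s : ℝ}
    (hc : A.center = B.center + (h • B.axis + l • A.axis - k • e))
    (hs : 0 ≤ s) (hsh : s ^ 2 + h ^ 2 = A.R ^ 2)
    (hin : (s - k) ^ 2 + l ^ 2 < B.R ^ 2) (hout : B.R ^ 2 < (s + k) ^ 2 + l ^ 2) :
    A.IsLinked B := by
  refine ⟨hd, fun hnull => ?_⟩
  obtain ⟨σ, hσ⟩ := (hnull.comp_right B.meridianMap).exists_sq_eq
  have hAR := A.R_pos
  have hmem : ∀ α : ℝ, A.center + A.R • (cos α • e + sin α • B.axis) ∈ A.centralCircle := by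
    intro α
    refine A.center_add_smul_mem_centralCircle ?_ ?_
    · rw [← pow_left_inj₀ (norm_nonneg _) zero_le_one two_ne_zero,
        norm_sq_add_smul hf.norm_fst hf.norm_snd hf.inner_fst_snd, cos_sq_add_sin_sq, one_pow]
    · rw [inner_add_right, inner_smul_right, inner_smul_right, real_inner_comm, hf.inner_fst_thd,
        real_inner_comm, hf.inner_snd_thd, mul_zero, mul_zero, add_zero]
  let γ : ℝ → A.centralCircle := fun α => ⟨_, hmem α⟩
  have hγ : Continuous γ := by
    refine Continuous.subtype_mk ?_ _
    fun_prop
  have hsub : ∀ α, (γ α : E3) - B.center =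
      ((A.R * cos α - k) • e + l • A.axis) + (h + A.R * sin α) • B.axis := by
    intro α
    change A.center + A.R • (cos α • e + sin α • B.axis) - B.center = _
    rw [hc]; module
  have hheight : ∀ α, inner ℝ B.axis ((γ α : E3) - B.center) = h + A.R * sin α := by
    intro α
    rw [hsub, inner_add_right, inner_add_right, inner_smul_right, inner_smul_right,
      inner_smul_right, real_inner_comm, hf.inner_fst_snd, hf.inner_snd_thd,
      real_inner_self_eq_norm_sq, B.norm_axis]
    ring
  have hplanar : ∀ α, ‖B.planar (γ α)‖ ^ 2 = (A.R * cos α - k) ^ 2 + l ^ 2 := by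
    intro α
    rw [planar, hheight, hsub, add_sub_cancel_right,
      norm_sq_add_smul hf.norm_fst hf.norm_thd hf.inner_fst_thd]
  have hre : ∀ α, (σ (γ α) ^ 2).re = (A.R * cos α - k) ^ 2 + l ^ 2 - B.R ^ 2 := by
    intro α
    rw [hσ, ← hplanar]
    rfl
  have him : ∀ α, (σ (γ α) ^ 2).im = h + A.R * sin α := by
    intro α
    rw [hσ, ← hheight]
    rfl
  have hne : ∀ x, σ x ≠ 0 := by
    intro x hx
    have := hσ x
    rw [hx, zero_pow two_ne_zero] at this
    exact (B.meridianMap.comp _ x).2 this.symm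
  have hh : |h| ≤ A.R := abs_le_of_sq_le_sq (by nlinarith [sq_nonneg s]) hAR.le
  obtain ⟨α, hα1, hα2, hsin, hcos⟩ : ∃ α, -(π / 2) ≤ α ∧ α ≤ π / 2 ∧ A.R * sin α = -h ∧
      A.R * cos α = s := by
    refine ⟨arcsin (-h / A.R), neg_pi_div_two_le_arcsin _, arcsin_le_pi_div_two _, ?_, ?_⟩
    · rw [sin_arcsin, mul_div_cancel₀ _ hAR.ne']
      · rw [le_div_iff₀ hAR]; linarith [(abs_le.1 hh).2]
      · rw [div_le_iff₀ hAR]; linarith [(abs_le.1 hh).1]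
    · have : 1 - (-h / A.R) ^ 2 = (s / A.R) ^ 2 := by
        field_simp; linarith
      rw [cos_arcsin, this, sqrt_sq (div_nonneg hs hAR.le), mul_div_cancel₀ _ hAR.ne']
  refine no_sqrt_of_winding (s := fun t => σ (γ t)) (a := α) (b := π - α) (c := α + 2 * π)
    (σ.continuous.comp hγ) (by linarith) (by linarith) ?_ (fun t => hne _) ?_ ?_ ?_ ?_ ?_ ?_
  · have : γ (α + 2 * π) = γ α := by
      apply Subtype.ext
      simp only [γ, cos_add_two_pi, sin_add_two_pi]
    simp only [this]
  · intro t ht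
    rw [him]
    nlinarith [sin_le_sin_of_mem_Icc hα1 ht]
  · intro t ht
    rw [him]
    nlinarith [sin_le_sin_of_mem_Icc' hα2 ht]
  · rw [hre, hcos]; linarith
  · rw [him, hsin]; ring
  · rw [hre, cos_pi_sub, mul_neg, hcos]; linarith
  · rw [him, sin_pi_sub, hsin]; ring

end StandardSolidTorus

namespace IsFrame

theorem norm_sq_eq {u v w : E3} (h : IsFrame u v w) (x y z : ℝ) :
    ‖x • u + y • v + z • w‖ ^ 2 = x ^ 2 + y ^ 2 + z ^ 2 := by
  rw [norm_add_sq_real, norm_sq_add_smul h.norm_fst h.norm_snd h.inner_fst_snd, norm_smul,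
    h.norm_thd, inner_add_left, inner_smul_left, inner_smul_left, inner_smul_right,
    inner_smul_right, h.inner_fst_thd, h.inner_snd_thd]
  simp

theorem neg_swap {u v w : E3} (h : IsFrame u v w) : IsFrame (-u) w v where
  norm_fst := by rw [norm_neg, h.norm_fst]
  norm_snd := h.norm_thd
  norm_thd := h.norm_snd
  inner_fst_snd := by rw [inner_neg_left, h.inner_fst_thd, neg_zero]
  inner_fst_thd := by rw [inner_neg_left, h.inner_fst_snd, neg_zero]
  inner_snd_thd := by rw [real_inner_comm, h.inner_snd_thd]

/-- The frame obtained by rotating the first two vectors: tangent vector (up to the sign `ε`) and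
radial vector at the angle `θ`. -/
theorem rotate {u v w : E3} (h : IsFrame u v w) {ε : ℝ} (hε : ε ^ 2 = 1) (θ : ℝ) :
    IsFrame (ε • (-sin θ • u + cos θ • v)) (cos θ • u + sin θ • v) w where
  norm_fst := by
    rw [← pow_left_inj₀ (norm_nonneg _) zero_le_one two_ne_zero, norm_smul, mul_pow,
      norm_sq_add_smul h.norm_fst h.norm_snd h.inner_fst_snd, norm_eq_abs, sq_abs, hε, neg_sq,
      sin_sq_add_cos_sq]
    norm_num
  norm_snd := by
    rw [← pow_left_inj₀ (norm_nonneg _) zero_le_one two_ne_zero,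
      norm_sq_add_smul h.norm_fst h.norm_snd h.inner_fst_snd, cos_sq_add_sin_sq, one_pow]
  norm_thd := h.norm_thd
  inner_fst_snd := by
    simp only [inner_add_left, inner_add_right, inner_smul_left, inner_smul_right,
      h.inner_fst_snd, real_inner_comm u v, real_inner_self_eq_norm_sq, h.norm_fst, h.norm_snd]
    simp
    ring
  inner_fst_thd := by
    simp [inner_add_left, inner_smul_left, h.inner_fst_thd, h.inner_snd_thd]
  inner_snd_thd := by
    simp [inner_add_left, inner_smul_left, h.inner_fst_thd, h.inner_snd_thd]

end IsFrame

namespace StandardSolidTorus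

/-! ### Pairs of neighbouring and of distant members of a chain -/

theorem disjoint_of_lt_dist_center {S T : StandardSolidTorus}
    (h : S.R + S.r + (T.R + T.r) < dist S.center T.center) : Disjoint S.carrier T.carrier := by
  refine Set.disjoint_left.2 fun x hS hT => ?_
  linarith [dist_center_le hS, dist_center_le hT, dist_triangle_left S.center T.center x]

theorem not_isLinked_of_lt_dist_center {S T : StandardSolidTorus}
    (h : S.R + S.r + (T.R + T.r) < dist S.center T.center) : ¬ S.IsLinked T := fun hl => by
  linarith [dist_center_lt_of_isLinked hl (disjoint_of_lt_dist_center h), S.r_pos, T.r_pos]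

/-- Bounds on the distance `d` of the centers of two tori with radii `R`, `r` and on the cosine
`c` and sine `s` of the angle between the direction of the centers and the plane of the second
torus that ensure that perpendicular tori are disjoint and linked. -/
structure LinkingBounds (R r d c s : ℝ) : Prop where
  sq_add_sq : c ^ 2 + s ^ 2 = 1
  pos : 0 < d
  lt_mul : R < d * c
  sq_lt : (d * s) ^ 2 + (d - R) ^ 2 < R ^ 2
  lt_two_mul : d < 2 * R * c
  four_mul_lt : 4 * r ^ 2 < (2 * R - d) ^ 2 - 2 * d * R * (2 * (1 - c) + |s|)

theorem LinkingBounds.sq_gap {R r d c s : ℝ} (h : LinkingBounds R r d c s) (hR : 0 < R)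
    {x y z w : ℝ} (hx : x ^ 2 + y ^ 2 = R ^ 2) (hz : z ^ 2 + w ^ 2 = R ^ 2) :
    4 * r ^ 2 < (x - d * c - z) ^ 2 + (y - d * s) ^ 2 + w ^ 2 := by
  have hc : c ≤ 1 := by nlinarith [h.sq_add_sq, sq_nonneg s, sq_nonneg (c - 1)]
  have hdc := h.lt_mul
  have hc0 : 0 < c := pos_of_mul_pos_right (hR.trans hdc) h.pos.le
  have hd : R < d := by
    by_contra! hle
    nlinarith [mul_nonneg hR.le (sub_nonneg.2 hc), mul_nonneg (sub_nonneg.2 hle) hc0.le]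
  have hd0 := h.pos
  have hxR := abs_le.1 (abs_le_of_sq_le_sq (by nlinarith [sq_nonneg y] : x ^ 2 ≤ R ^ 2) hR.le)
  have hyR := abs_le_of_sq_le_sq (by nlinarith [sq_nonneg x] : y ^ 2 ≤ R ^ 2) hR.le
  have hzR := abs_le.1 (abs_le_of_sq_le_sq (by nlinarith [sq_nonneg w] : z ^ 2 ≤ R ^ 2) hR.le)
  have hsy : s * y ≤ |s| * R := (le_abs_self _).trans (by
    rw [abs_mul]; exact mul_le_mul_of_nonneg_left hyR (abs_nonneg _))
  -- Without tilt (`c = 1`, `s = 0`) the minimum `(2 * R - d) ^ 2` occurs at `x = R`, `z = -R`,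
  -- where `e1` and `e2` vanish; `e3` and `e4` bound the effect of the tilt.
  have e1 : 0 ≤ (d - R) * ((R - x) + (R + z)) :=
    mul_nonneg (by linarith) (by linarith)
  have e2 : 0 ≤ (R - x) * (R + z) := mul_nonneg (by linarith) (by linarith)
  have e3 : 0 ≤ d * (1 - c) * (2 * R + x - z) :=
    mul_nonneg (mul_nonneg hd0.le (by linarith)) (by linarith)
  have e4 := mul_le_mul_of_nonneg_left hsy hd0.le
  have e5 : d ^ 2 * c ^ 2 + d ^ 2 * s ^ 2 = d ^ 2 := by
    rw [← mul_add, h.sq_add_sq, mul_one]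
  have key : (x - d * c - z) ^ 2 + (y - d * s) ^ 2 + w ^ 2 =
      (2 * R - d) ^ 2 - 2 * d * R * (2 * (1 - c) + |s|) + 2 * ((d - R) * ((R - x) + (R + z))) +
      2 * ((R - x) * (R + z)) + 2 * (d * (1 - c) * (2 * R + x - z)) +
      2 * (d * (|s| * R) - d * (s * y)) := by
    linear_combination hx + hz + e5
  rw [key]
  linarith [h.four_mul_lt]

section Perpendicular

variable {S T : StandardSolidTorus} {τ : E3} {d c s : ℝ}

theorem LinkingBounds.disjoint (h : LinkingBounds S.R S.r d c s) (hf : IsFrame τ T.axis S.axis)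
    (hc : S.center = T.center - d • (c • τ + s • T.axis)) (hR : T.R = S.R) (hr : T.r = S.r) :
    Disjoint S.carrier T.carrier := by
  refine disjoint_carrier_iff.2 fun x hx y hy => ?_
  have hX := hf.eq_sum (x - S.center)
  have hY := hf.eq_sum (y - T.center)
  rw [hx.1, zero_smul, add_zero] at hX
  rw [hy.1, zero_smul, add_zero] at hY
  set X₁ : ℝ := inner ℝ τ (x - S.center)
  set X₂ : ℝ := inner ℝ T.axis (x - S.center)
  set Y₁ : ℝ := inner ℝ τ (y - T.center)
  set Y₂ : ℝ := inner ℝ S.axis (y - T.center)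
  have hXn : X₁ ^ 2 + X₂ ^ 2 = S.R ^ 2 := by
    rw [← norm_sq_add_smul hf.norm_fst hf.norm_snd hf.inner_fst_snd, ← hX, ← dist_eq_norm, hx.2]
  have hYn : Y₁ ^ 2 + Y₂ ^ 2 = S.R ^ 2 := by
    rw [← norm_sq_add_smul hf.norm_fst hf.norm_thd hf.inner_fst_thd, ← hY, ← dist_eq_norm, hy.2, hR]
  have hxy : x - y = (X₁ - d * c - Y₁) • τ + (X₂ - d * s) • T.axis + (-Y₂) • S.axis := by
    have : x - y = (x - S.center) - (y - T.center) + (S.center - T.center) := by abel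
    rw [this, hX, hY, hc]
    module
  refine lt_of_pow_lt_pow_left₀ 2 dist_nonneg ?_
  rw [dist_eq_norm, hxy, hf.norm_sq_eq, hr, neg_sq]
  linarith [h.sq_gap S.R_pos hXn hYn]

theorem LinkingBounds.isLinked (h : LinkingBounds S.R S.r d c s) (hf : IsFrame τ T.axis S.axis)
    (hc : S.center = T.center - d • (c • τ + s • T.axis)) (hR : T.R = S.R) (hr : T.r = S.r) :
    S.IsLinked T := by
  have hRp := S.R_pos
  have hlt := h.lt_mul
  have hsq : 0 ≤ S.R ^ 2 - (d * s) ^ 2 := by nlinarith [h.sq_lt, sq_nonneg (d - S.R)]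
  have hc1 : c ≤ 1 := by nlinarith [h.sq_add_sq, sq_nonneg s, sq_nonneg (c - 1)]
  have hd0 := h.pos
  have hc0 : 0 < c := pos_of_mul_pos_right (hRp.trans hlt) hd0.le
  have hdc : d * c ≤ d := mul_le_of_le_one_right hd0.le hc1
  have ht := Real.sq_sqrt hsq
  have ht0 := Real.sqrt_nonneg (S.R ^ 2 - (d * s) ^ 2)
  -- `t` is half the chord that the plane of `T` cuts from the circle of `S`.
  set t := √(S.R ^ 2 - (d * s) ^ 2)
  have htR : t ≤ S.R := le_of_sq_le_sq (by rw [ht]; nlinarith [sq_nonneg (d * s)]) hRp.le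
  have htd : d - S.R < t := lt_of_pow_lt_pow_left₀ 2 ht0 (by rw [ht]; linarith [h.sq_lt])
  refine isLinked_of_crossing (k := d * c) (h := -(d * s)) (l := 0) (s := t) ?_ hf ?_ ht0 ?_ ?_ ?_
  · intro x hx hx'
    have := disjoint_carrier_iff.1 (h.disjoint hf hc hR hr) x hx x hx'
    rw [dist_self] at this
    linarith [S.r_pos, T.r_pos]
  · rw [hc]; module
  · rw [ht]; ring
  · rw [hR, zero_pow two_ne_zero, add_zero]
    exact sq_lt_sq' (by linarith) (by linarith)
  · rw [hR, zero_pow two_ne_zero, add_zero]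
    exact pow_lt_pow_left₀ (by linarith) hRp.le two_ne_zero

/-- `IsLinked` is not symmetric by definition, so both orders need a proof. Here the plane of `S`
cuts the circle of `T` in a diameter, and `lt_two_mul` puts one of its ends inside the circle of
`S`. -/
theorem LinkingBounds.isLinked' (h : LinkingBounds S.R S.r d c s) (hf : IsFrame τ T.axis S.axis)
    (hc : S.center = T.center - d • (c • τ + s • T.axis)) (hR : T.R = S.R) (hr : T.r = S.r) :
    T.IsLinked S := by
  have hRp := S.R_pos
  have hlt := h.lt_mul
  have hd0 := h.pos
  have hc0 : 0 < c := pos_of_mul_pos_right (hRp.trans hlt) hd0.le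
  have e5 : (d * c) ^ 2 + (d * s) ^ 2 = d ^ 2 := by
    rw [mul_pow, mul_pow, ← mul_add, h.sq_add_sq, mul_one]
  refine isLinked_of_crossing (k := d * c) (h := 0) (l := d * s) (s := S.R) ?_ hf.neg_swap ?_
    hRp.le ?_ ?_ ?_
  · intro x hx hx'
    have := disjoint_carrier_iff.1 (h.disjoint hf hc hR hr) x hx' x hx
    rw [dist_self] at this
    linarith [S.r_pos, T.r_pos]
  · rw [hc]; module
  · rw [hR]; ring
  · nlinarith [mul_lt_mul_of_pos_left h.lt_two_mul hd0]
  · nlinarith [mul_pos hRp (mul_pos hd0 hc0), sq_nonneg d]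

end Perpendicular

end StandardSolidTorus

theorem cos_le_cos_of_mem_Icc {α β : ℝ} (hα : 0 ≤ α) (hβ : β ∈ Set.Icc α (2 * π - α)) :
    cos β ≤ cos α := by
  rw [← sub_nonpos, cos_sub_cos, neg_mul, neg_mul, neg_nonpos]
  refine mul_nonneg (mul_nonneg two_pos.le (sin_nonneg_of_mem_Icc ⟨?_, ?_⟩))
    (sin_nonneg_of_mem_Icc ⟨?_, ?_⟩) <;> linarith [hβ.1, hβ.2]

namespace StandardSolidTorus

/-! ### The ring of solid tori -/

section Ring

variable (B : StandardSolidTorus) (u v a : E3) (ρ δ : ℝ)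

/-- The `i`-th member of the ring of copies of `B` with centers at the angles `2 * δ * i` on the
circle of radius `ρ` in the plane of `u` and `v`: horizontal members alternate with members
perpendicular to the radial direction. -/
def ringMember (hf : IsFrame u v a) (i : ℕ) : StandardSolidTorus where
  center := ρ • (cos (2 * δ * i) • u + sin (2 * δ * i) • v)
  axis := if Even i then a else cos (2 * δ * i) • u + sin (2 * δ * i) • v
  R := B.R
  r := B.r
  norm_axis := by
    split_ifs
    · exact hf.norm_thd
    · exact (hf.rotate (one_pow 2) _).norm_snd
  r_pos := B.r_pos
  r_lt_R := B.r_lt_R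

/-- A torus similar to `B` about the circle that carries the centers of a ring. -/
def ringTorus (hf : IsFrame u v a) (hρ : 0 < ρ) : StandardSolidTorus where
  center := 0
  axis := a
  R := ρ
  r := ρ / B.R * B.r
  norm_axis := hf.norm_thd
  r_pos := mul_pos (div_pos hρ B.R_pos) B.r_pos
  r_lt_R := by
    rw [div_mul_eq_mul_div, div_lt_iff₀ B.R_pos]
    exact mul_lt_mul_of_pos_left B.r_lt_R hρ

variable {B u v a ρ δ}

/-- A chord subtending the angle `2 * δ` has length `2 * ρ * sin δ` and makes the angle `δ` with the
tangent; `ε` selects the side. -/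
theorem ring_center_sub {ε : ℝ} (hε : ε = 1 ∨ ε = -1) (θ : ℝ) :
    ρ • (cos (θ - ε * (2 * δ)) • u + sin (θ - ε * (2 * δ)) • v) =
      ρ • (cos θ • u + sin θ • v) - (2 * ρ * sin δ) •
        (cos δ • (ε • (-sin θ • u + cos θ • v)) + sin δ • (cos θ • u + sin θ • v)) := by
  have h1 : cos (2 * δ) = 1 - 2 * sin δ ^ 2 := by rw [cos_two_mul, cos_sq']; ring
  rcases hε with rfl | rfl
  · rw [one_mul, cos_sub, sin_sub, h1, sin_two_mul]
    module
  · rw [neg_one_mul, sub_neg_eq_add, cos_add, sin_add, h1, sin_two_mul]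
    module

/-- The bound is the chord `2 * ρ * sin (2 * δ)` over two steps, the shortest between
non-neighbours. -/
theorem two_mul_cos_le_dist_ringMember (hf : IsFrame u v a) {m : ℕ} (hm : 2 ≤ m)
    (hδ : δ = π / (2 * m)) {i j : ℕ} (hij : i + 2 ≤ j) (hji : j + 2 ≤ i + 2 * m) :
    2 * (2 * ρ * sin δ) * cos δ ≤
      dist (ringMember B u v a ρ δ hf i).center (ringMember B u v a ρ δ hf j).center := by
  have hm0 : (0 : ℝ) < m := by exact_mod_cast (by omega : 0 < m)
  have hδ0 : 0 ≤ δ := by rw [hδ]; positivity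
  have hmδ : 2 * δ * m = π := by rw [hδ]; field_simp
  refine le_of_sq_le_sq ?_ dist_nonneg
  have h1 : dist (ringMember B u v a ρ δ hf i).center (ringMember B u v a ρ δ hf j).center ^ 2 =
      ρ ^ 2 * (2 - 2 * cos (2 * δ * j - 2 * δ * i)) := by
    have : (ringMember B u v a ρ δ hf i).center - (ringMember B u v a ρ δ hf j).center =
        (ρ * (cos (2 * δ * i) - cos (2 * δ * j))) • u +
          (ρ * (sin (2 * δ * i) - sin (2 * δ * j))) • v := by
      simp only [ringMember]; module
    rw [dist_eq_norm, this, norm_sq_add_smul hf.norm_fst hf.norm_snd hf.inner_fst_snd, cos_sub]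
    linear_combination ρ ^ 2 * (sin_sq_add_cos_sq (2 * δ * i)) +
      ρ ^ 2 * (sin_sq_add_cos_sq (2 * δ * j))
  have h2 : cos (2 * δ * j - 2 * δ * i) ≤ cos (2 * (2 * δ)) := by
    have hij' : (i : ℝ) + 2 ≤ j := by exact_mod_cast hij
    have hji' : (j : ℝ) + 2 ≤ i + 2 * m := by exact_mod_cast hji
    refine cos_le_cos_of_mem_Icc (by positivity) ⟨?_, ?_⟩
    · nlinarith [mul_le_mul_of_nonneg_left hij' hδ0]
    · nlinarith [mul_le_mul_of_nonneg_left hji' hδ0]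
  have h3 : cos (2 * (2 * δ)) = 1 - 2 * (2 * sin δ * cos δ) ^ 2 := by
    rw [cos_two_mul, cos_sq', sin_two_mul]; ring
  rw [h1]
  rw [h3] at h2
  nlinarith [mul_le_mul_of_nonneg_left h2 (sq_nonneg ρ)]

theorem ringMember_neighbours_of_even (hf : IsFrame u v a) {m : ℕ} (hm : 2 ≤ m) (hδ : δ = π / (2 * m))
    (hb : LinkingBounds B.R B.r (2 * ρ * sin δ) (cos δ) (sin δ)) {i j : ℕ} (hi : Even i)
    (hij : (i : ℤ) - j ≡ 1 [ZMOD (2 * m : ℕ)] ∨ (j : ℤ) - i ≡ 1 [ZMOD (2 * m : ℕ)]) :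
    Disjoint (ringMember B u v a ρ δ hf i).carrier (ringMember B u v a ρ δ hf j).carrier ∧
      (ringMember B u v a ρ δ hf i).IsLinked (ringMember B u v a ρ δ hf j) ∧
      (ringMember B u v a ρ δ hf j).IsLinked (ringMember B u v a ρ δ hf i) := by
  have hm0 : (0 : ℝ) < m := by exact_mod_cast (by omega : 0 < m)
  have hmδ : 2 * δ * m = π := by rw [hδ]; field_simp
  -- `ε` records on which side the neighbour lies, `l` the wrap-around of the index; the latter adds
  -- full turns to the angle and preserves parity.
  obtain ⟨ε, l, hε, hl⟩ : ∃ (ε l : ℤ), (ε = 1 ∨ ε = -1) ∧ (i : ℤ) = j - ε + 2 * m * l := by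
    rcases hij with h | h
    · obtain ⟨l, hl⟩ := h.dvd
      push_cast at hl
      exact ⟨-1, -l, Or.inr rfl, by linarith⟩
    · obtain ⟨l, hl⟩ := h.dvd
      push_cast at hl
      exact ⟨1, l, Or.inl rfl, by linarith⟩
  have hj : ¬ Even j := by
    intro hj
    have h1 : (i : ℤ) % 2 = 0 := by exact_mod_cast Nat.even_iff.1 hi
    have h2 : (j : ℤ) % 2 = 0 := by exact_mod_cast Nat.even_iff.1 hj
    have h3 : (2 * m * l : ℤ) = 2 * (m * l) := by ring
    rw [h3] at hl
    omega
  have hε' : (ε : ℝ) = 1 ∨ (ε : ℝ) = -1 := by exact_mod_cast hε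
  have hε2 : (ε : ℝ) ^ 2 = 1 := by rcases hε' with h | h <;> rw [h] <;> norm_num
  have hang : 2 * δ * i = 2 * δ * j - ε * (2 * δ) + l * (2 * π) := by
    have : (i : ℝ) = j - ε + 2 * m * l := by exact_mod_cast hl
    rw [this, ← hmδ]; ring
  have hc : (ringMember B u v a ρ δ hf i).center = (ringMember B u v a ρ δ hf j).center -
      (2 * ρ * sin δ) • (cos δ • ((ε : ℝ) • (-sin (2 * δ * j) • u + cos (2 * δ * j) • v)) +
        sin δ • (ringMember B u v a ρ δ hf j).axis) := by
    simp only [ringMember, if_neg hj]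
    rw [← ring_center_sub hε', hang, cos_add_int_mul_two_pi, sin_add_int_mul_two_pi]
  have hfr : IsFrame ((ε : ℝ) • (-sin (2 * δ * j) • u + cos (2 * δ * j) • v))
      (ringMember B u v a ρ δ hf j).axis (ringMember B u v a ρ δ hf i).axis := by
    simp only [ringMember, if_neg hj, if_pos hi]
    exact hf.rotate hε2 _
  have hb' : LinkingBounds (ringMember B u v a ρ δ hf i).R (ringMember B u v a ρ δ hf i).r
    (2 * ρ * sin δ) (cos δ) (sin δ) := hb
  exact ⟨hb'.disjoint hfr hc rfl rfl, hb'.isLinked hfr hc rfl rfl, hb'.isLinked' hfr hc rfl rfl⟩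

theorem ringMember_neighbours (hf : IsFrame u v a) {m : ℕ} (hm : 2 ≤ m) (hδ : δ = π / (2 * m))
    (hb : LinkingBounds B.R B.r (2 * ρ * sin δ) (cos δ) (sin δ)) {i j : ℕ}
    (hij : (i : ℤ) - j ≡ 1 [ZMOD (2 * m : ℕ)] ∨ (j : ℤ) - i ≡ 1 [ZMOD (2 * m : ℕ)]) :
    Disjoint (ringMember B u v a ρ δ hf i).carrier (ringMember B u v a ρ δ hf j).carrier ∧
      (ringMember B u v a ρ δ hf i).IsLinked (ringMember B u v a ρ δ hf j) := by
  by_cases hi : Even i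
  · obtain ⟨h1, h2, -⟩ := ringMember_neighbours_of_even hf hm hδ hb hi hij
    exact ⟨h1, h2⟩
  · have hj : Even j := by
      have h2 : (i : ℤ) - j ≡ 1 [ZMOD 2] ∨ (j : ℤ) - i ≡ 1 [ZMOD 2] := by
        push_cast at hij
        exact hij.imp (Int.ModEq.of_mul_right _) (Int.ModEq.of_mul_right _)
      simp only [Int.ModEq] at h2
      rw [Nat.even_iff] at hi ⊢
      omega
    obtain ⟨h1, -, h3⟩ := ringMember_neighbours_of_even hf hm hδ hb hj hij.symm
    exact ⟨h1.symm, h3⟩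

theorem ringMember_distant (hf : IsFrame u v a) {m : ℕ} (hm : 2 ≤ m)
    (hδ : δ = π / (2 * m)) (hb : B.R + B.r < 2 * ρ * sin δ * cos δ) {i j : ℕ}
    (hne : i ≠ j) (hi : i < 2 * m) (hj : j < 2 * m)
    (hij : ¬ ((i : ℤ) - j ≡ 1 [ZMOD (2 * m : ℕ)] ∨ (j : ℤ) - i ≡ 1 [ZMOD (2 * m : ℕ)])) :
    Disjoint (ringMember B u v a ρ δ hf i).carrier (ringMember B u v a ρ δ hf j).carrier ∧
      ¬ (ringMember B u v a ρ δ hf i).IsLinked (ringMember B u v a ρ δ hf j) := by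
  have hd : (ringMember B u v a ρ δ hf i).R + (ringMember B u v a ρ δ hf i).r +
      ((ringMember B u v a ρ δ hf j).R + (ringMember B u v a ρ δ hf j).r) <
      dist (ringMember B u v a ρ δ hf i).center (ringMember B u v a ρ δ hf j).center := by
    change B.R + B.r + (B.R + B.r) < _
    have h1 : (i : ℤ) - j ≠ 1 := fun h => hij (Or.inl (by rw [h]))
    have h2 : (j : ℤ) - i ≠ 1 := fun h => hij (Or.inr (by rw [h]))
    -- The first and last members are neighbours too and must be excluded.
    have h3 : (i : ℤ) - j ≠ 1 - (2 * m : ℕ) := fun h => hij (Or.inl (by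
      rw [h]; exact Int.sub_modulus_modEq_iff.2 rfl))
    have h4 : (j : ℤ) - i ≠ 1 - (2 * m : ℕ) := fun h => hij (Or.inr (by
      rw [h]; exact Int.sub_modulus_modEq_iff.2 rfl))
    rcases lt_or_gt_of_ne hne with hlt | hlt
    · linarith [two_mul_cos_le_dist_ringMember (B := B) (ρ := ρ) hf hm hδ
        (by omega : i + 2 ≤ j) (by omega)]
    · rw [dist_comm]
      linarith [two_mul_cos_le_dist_ringMember (B := B) (ρ := ρ) hf hm hδ
        (by omega : j + 2 ≤ i) (by omega)]
  exact ⟨disjoint_of_lt_dist_center hd, not_isLinked_of_lt_dist_center hd⟩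

theorem isRegularSimpleChain_ring (hf : IsFrame u v a) {m : ℕ} (hm : 2 ≤ m)
    (hδ : δ = π / (2 * m)) (hρ : 0 < ρ)
    (hb : LinkingBounds B.R B.r (2 * ρ * sin δ) (cos δ) (sin δ))
    (hd : B.R + B.r < 2 * ρ * sin δ * cos δ) (hr : B.R + B.r ≤ ρ / B.R * B.r) :
    (ringTorus B u v a ρ hf hρ).IsRegularSimpleChain
      (fun i : Fin (2 * m) => ringMember B u v a ρ δ hf i) where
  three_le := by omega
  two_le := hm
  congruent i j := isCongruent_of_eq rfl rfl
  disjoint i j hij := by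
    by_cases h : ((i : ℕ) : ℤ) - ((j : ℕ) : ℤ) ≡ 1 [ZMOD (2 * m : ℕ)] ∨
        ((j : ℕ) : ℤ) - ((i : ℕ) : ℤ) ≡ 1 [ZMOD (2 * m : ℕ)]
    · exact (ringMember_neighbours hf hm hδ hb h).1
    · exact (ringMember_distant hf hm hδ hd (Fin.val_ne_of_ne hij) i.2 j.2 h).1
  linked_iff i j hij := by
    by_cases h : ((i : ℕ) : ℤ) - ((j : ℕ) : ℤ) ≡ 1 [ZMOD (2 * m : ℕ)] ∨
        ((j : ℕ) : ℤ) - ((i : ℕ) : ℤ) ≡ 1 [ZMOD (2 * m : ℕ)]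
    · exact iff_of_true (ringMember_neighbours hf hm hδ hb h).2 h
    · exact iff_of_false
        (ringMember_distant hf hm hδ hd (Fin.val_ne_of_ne hij) i.2 j.2 h).2 h
  subset i x hx := by
    refine mem_carrier.2 ⟨_, ?_, (dist_center_le hx).trans hr⟩
    have h := hf.rotate (one_pow 2) (2 * δ * (i : ℕ))
    have := (ringTorus B u v a ρ hf hρ).center_add_smul_mem_centralCircle h.norm_snd
      ((real_inner_comm _ _).trans h.inner_snd_thd)
    rwa [show (ringTorus B u v a ρ hf hρ).center = 0 from rfl, zero_add] at this
  centers := by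
    refine ⟨u, v, hf.norm_fst, hf.norm_snd, hf.inner_fst_snd,
      (real_inner_comm _ _).trans hf.inner_fst_thd,
      (real_inner_comm _ _).trans hf.inner_snd_thd, fun i => ?_⟩
    have h : 2 * π * (i : ℕ) / ((2 * m : ℕ) : ℝ) = 2 * δ * (i : ℕ) := by
      rw [hδ]; push_cast; ring
    rw [h]
    simp only [ringMember, ringTorus, zero_add]
  coplanar i hi := by
    ext x
    rw [mem_plane, mem_plane]
    have h := (hf.rotate (one_pow 2) (2 * δ * (i : ℕ))).inner_snd_thd
    simp only [ringMember, ringTorus, if_pos hi, sub_zero]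
    rw [inner_sub_right, inner_smul_right, real_inner_comm (_ + _) a, h, mul_zero, sub_zero]
  perpendicular i hi := by
    have h := (hf.rotate (one_pow 2) (2 * δ * (i : ℕ))).inner_snd_thd
    rw [plane_eq_mk', plane_eq_mk', AffineSubspace.direction_mk', AffineSubspace.direction_mk',
      Submodule.orthogonal_orthogonal, Submodule.orthogonal_orthogonal]
    simp only [ringMember, ringTorus, if_neg (Nat.not_even_iff_odd.2 hi)]
    exact Submodule.isOrtho_span.2 (by simpa using h)
  touches i hi := by
    have h := hf.rotate (one_pow 2) (2 * δ * (i : ℕ))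
    set w := cos (2 * δ * (i : ℕ)) • u + sin (2 * δ * (i : ℕ)) • v with hw
    have hax : (ringMember B u v a ρ δ hf i).axis = w := if_neg (Nat.not_even_iff_odd.2 hi)
    have hce : (ringMember B u v a ρ δ hf i).center = ρ • w := rfl
    have hT : ∀ x, x ∈ (ringTorus B u v a ρ hf hρ).centralCircle ↔ inner ℝ a x = 0 ∧ ‖x‖ = ρ := by
      intro x
      rw [mem_centralCircle]
      simp [ringTorus]
    have hwa : inner ℝ a w = 0 := (real_inner_comm _ _).trans h.inner_snd_thd
    refine ⟨ρ • w, ⟨⟨?_, ?_⟩, ?_⟩, ?_⟩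
    · exact mem_plane.2 (by rw [hce, sub_self, inner_zero_right])
    · refine mem_plane.2 ?_
      simp only [ringTorus, sub_zero]
      rw [inner_smul_right, hwa, mul_zero]
    · rw [hT, inner_smul_right, hwa, mul_zero, norm_smul, h.norm_snd, mul_one, norm_of_nonneg hρ.le]
      exact ⟨rfl, rfl⟩
    · rintro x ⟨⟨hx, -⟩, hxT⟩
      have h1 := mem_plane.1 hx
      rw [hax, hce, inner_sub_right, inner_smul_right, real_inner_self_eq_norm_sq, h.norm_snd,
        one_pow, mul_one, sub_eq_zero, real_inner_comm] at h1
      have h2 := ((hT x).1 hxT).2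
      rw [← sub_eq_zero, ← norm_eq_zero, ← sq_eq_zero_iff, norm_sub_sq_real, inner_smul_right, h1,
        norm_smul, h.norm_snd, h2, mul_one, norm_eq_abs, sq_abs]
      ring

end Ring

/-! ### Choice of the distance and assembly of the ring. -/

theorem eventually_linkingBounds {R r : ℝ} (hr : 0 < r) (h : 3 * r < R) :
    ∀ᶠ δ in 𝓝[>] (0 : ℝ), 0 < sin δ ∧ LinkingBounds R r ((3 * R - r) / 2) (cos δ) (sin δ) ∧
      R + r < (3 * R - r) / 2 * cos δ ∧ (R + r) * (2 * sin δ) * R < (3 * R - r) / 2 * r := by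
  -- The midpoint of `R + r` and `2 * R - 2 * r`. Each bound is strict at `δ = 0` and continuous in
  -- `δ`; only `0 < sin δ` needs the one-sided limit.
  obtain ⟨d, hd⟩ : ∃ d, d = (3 * R - r) / 2 := ⟨_, rfl⟩
  rw [← hd]
  have hlim : ∀ (f : ℝ → ℝ) (x : ℝ), Continuous f → x < f 0 → ∀ᶠ δ in 𝓝[>] (0 : ℝ), x < f δ :=
    fun f x hf hx => (hf.continuousAt.eventually (lt_mem_nhds hx)).filter_mono nhdsWithin_le_nhds
  filter_upwards [Ioo_mem_nhdsGT pi_pos,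
    hlim (fun δ => d * cos δ) (R + r) (by fun_prop) (by simp; linarith),
    hlim (fun δ => R ^ 2 - ((d * sin δ) ^ 2 + (d - R) ^ 2)) 0 (by fun_prop)
      (by simp; nlinarith),
    hlim (fun δ => 2 * R * cos δ) d (by fun_prop) (by simp; linarith),
    hlim (fun δ => (2 * R - d) ^ 2 - 2 * d * R * (2 * (1 - cos δ) + |sin δ|)) (4 * r ^ 2)
      (by fun_prop) (by simp; nlinarith),
    hlim (fun δ => d * r - (R + r) * (2 * sin δ) * R) 0 (by fun_prop)
      (by simp; exact mul_pos (by linarith) hr)] with δ h1 h2 h3 h4 h5 h6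
  exact ⟨sin_pos_of_mem_Ioo h1, ⟨cos_sq_add_sin_sq δ, by linarith, by linarith, by linarith, h4, h5⟩,
    h2, by linarith⟩

theorem exists_ring (B : StandardSolidTorus) (h : 3 * B.r < B.R) :
    ∃ M : ℕ, ∀ m : ℕ, M ≤ m → ∃ (T : StandardSolidTorus) (c : Fin (2 * m) → StandardSolidTorus),
      T.IsRegularSimpleChain c ∧ (∀ i, (c i).IsCongruent B) ∧ T.IsSimilar B := by
  obtain ⟨u, hu, hau, -⟩ := exists_unit_orthogonal B.axis B.axis
  obtain ⟨v, hv, hav, huv⟩ := exists_unit_orthogonal B.axis u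
  have hf : IsFrame u v B.axis := ⟨hu, hv, B.norm_axis, huv, (real_inner_comm _ _).trans hau,
    (real_inner_comm _ _).trans hav⟩
  have hlim : Tendsto (fun m : ℕ => π / (2 * (m : ℝ))) atTop (𝓝[>] 0) := by
    refine tendsto_nhdsWithin_iff.2 ⟨?_, ?_⟩
    · exact tendsto_const_nhds.div_atTop
        (tendsto_natCast_atTop_atTop.const_mul_atTop two_pos)
    · filter_upwards [eventually_gt_atTop 0] with m hm
      have : (0 : ℝ) < m := by exact_mod_cast hm
      exact div_pos pi_pos (by linarith)
  obtain ⟨M, hM⟩ := eventually_atTop.1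
    ((hlim.eventually (eventually_linkingBounds B.r_pos h)).and (eventually_ge_atTop 2))
  refine ⟨M, fun m hm => ?_⟩
  obtain ⟨⟨hsin, hb, hd, hr⟩, hm2⟩ := hM m hm
  obtain ⟨δ, hδ⟩ : ∃ δ, δ = π / (2 * (m : ℝ)) := ⟨_, rfl⟩
  rw [← hδ] at hsin hb hd hr
  -- The radius is adapted to `m` so that the distance of neighbours stays fixed.
  obtain ⟨ρ, hρ⟩ : ∃ ρ, 2 * ρ * sin δ = (3 * B.R - B.r) / 2 :=
    ⟨(3 * B.R - B.r) / 2 / (2 * sin δ), by field_simp⟩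
  rw [← hρ] at hb hd hr
  have hρ0 : 0 < ρ := by
    have := pos_of_mul_pos_left hb.pos hsin.le
    linarith
  refine ⟨ringTorus B u v B.axis ρ hf hρ0, _,
    isRegularSimpleChain_ring hf hm2 hδ hρ0 hb hd ?_, fun i => isCongruent_of_eq rfl rfl,
    isSimilar_of_eq (k := B.R / ρ) (div_pos B.R_pos hρ0) rfl rfl ?_ ?_⟩
  · rw [div_mul_eq_mul_div, le_div_iff₀ B.R_pos]
    nlinarith
  · exact (div_mul_cancel₀ _ hρ0.ne').symm
  · change B.r = B.R / ρ * (ρ / B.R * B.r)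
    have := B.R_pos
    field_simp

end StandardSolidTorus

end

theorem theorem2 (B : StandardSolidTorus) :
    List.TFAE [
      B.R > 3 * B.r,
      ∃ M : ℕ, ∀ m : ℕ, M ≤ m →
        ∃ (T : StandardSolidTorus) (c : Fin (2 * m) → StandardSolidTorus),
          T.IsRegularSimpleChain c ∧ ∀ i, (c i).IsCongruent B,
      ∃ M : ℕ, ∀ m : ℕ, M ≤ m →
        ∃ (T : StandardSolidTorus) (c : Fin (2 * m) → StandardSolidTorus),
          T.IsRegularSimpleChain c ∧ (∀ i, (c i).IsCongruent B) ∧ T.IsSimilar B] := by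
  tfae_have 1 → 3 := B.exists_ring
  tfae_have 3 → 2 := fun ⟨M, h⟩ => ⟨M, fun m hm =>
    let ⟨T, c, hc, hB, _⟩ := h m hm
    ⟨T, c, hc, hB⟩⟩
  tfae_have 2 → 1 := fun ⟨M, h⟩ =>
    let ⟨_, _, hc, hB⟩ := h M le_rfl
    hc.three_mul_r_lt hB
  tfae_finish
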